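/- For $k\in\mathbb N$ let $n=2^k$ and let $H:\mathbb F_2^k\to\mathbb F_2^n$ be the Hadamard code, $H(x)=(\langle x,z\rangle)_{z\in\mathbb F_2^k}$ with $\langle x,z\rangle=\sum_i x_iz_i$; let $d$ denote the Hamming distance. Consider circuits that act on qubits initialized to $|0\rangle$ and on classical bits (the input bits, and work bits initialized to $0$) by four kinds of operations: arbitrary single-qubit unitary gates and CNOT gates, each possibly controlled by a classical bit; computational-basis measurements of a qubit whose outcome is written to a classical bit; and classical parity gates of unbounded fan-in. A layer consists of operations that act on pairwise disjoint qubits and none of which writes a classical bit that another one of them reads or writes; the depth is the number of layers (of gates, measurements and parity gates alike). A family of $\mathsf{QNC}^0[\oplus]$-circuits is a family of such circuits of constant depth and of size polynomial in the number of input bits. There are a family of $\mathsf{QNC}^0[\oplus]$-circuits $(\mathcal C_n)_{n=2^k,\,k\in\mathbb N}$, where $\mathcal C_n$ has $n$ input bits, $k$ output bits and depth at most $65$, and an absolute constant $c>0$ such that the following holds. For every $k\in\mathbb N$, $n=2^k$, every $\varepsilon\in(0,1/2]$, every $y\in\mathbb F_2^n$ and every $x\in\mathbb F_2^k$ with $d(y,H(x))\le(\tfrac12-\varepsilon)n$,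 on input $y$ the circuit $\mathcal C_n$ outputs $x$ with probability at least $c\,\varepsilon^2$. -/

import Mathlib

/-- An elementary operation on qubits `Q` and classical bits `B`. Quantum gates are all single-qubit
unitaries and CNOT; each may be controlled by a classical bit (`ctrl = some b`: the gate is applied
iff bit `b` equals `1`; `ctrl = none`: it is always applied). `measure i a` measures qubit `i` in the
computational basis and stores the outcome in bit `a`. `parity S a` is the classical parity gate of
unbounded fan-in, storing the sum modulo 2 of the bits in `S` in bit `a`. -/
inductive Op (Q B : Type) : Type
  | gate (U : Matrix.unitaryGroup (ZMod 2) ℂ) (i : Q) (ctrl : Option B)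
  | cnot (i j : Q) (hij : i ≠ j) (ctrl : Option B)
  | measure (i : Q) (a : B)
  | parity (S : Finset B) (a : B)

namespace Op

variable {Q B : Type}

/-- The qubits an operation acts on. -/
def qubits [DecidableEq Q] : Op Q B → Finset Q
  | gate _ i _ => {i}
  | cnot i j _ _ => {i, j}
  | measure i _ => {i}
  | parity _ _ => ∅

/-- The classical bits an operation reads. -/
def reads : Op Q B → Finset B
  | gate _ _ ctrl => ctrl.toFinset
  | cnot _ _ _ ctrl => ctrl.toFinset
  | measure _ _ => ∅
  | parity S _ => S

/-- The classical bits an operation writes. -/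
def writes : Op Q B → Finset B
  | gate _ _ _ => ∅
  | cnot _ _ _ _ => ∅
  | measure _ a => {a}
  | parity _ a => {a}

/-- Two operations are independent, so that they can be carried out in the same layer, if they act
on disjoint sets of qubits and neither writes a classical bit that the other reads or writes.
(Several operations may read the same classical bit.) -/
def Independent [DecidableEq Q] (o p : Op Q B) : Prop :=
  Disjoint o.qubits p.qubits ∧ Disjoint o.writes p.writes ∧
    Disjoint o.writes p.reads ∧ Disjoint o.reads p.writes

end Op

/-- One measurement branch of a computation: the contents of the classical bits and the
unnormalized state vector of the qubits, by its amplitudes in the computational basis. The squared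
norm of the vector is the probability of the branch. -/
structure Branch (Q B : Type) : Type where
  bits : B → ZMod 2
  amp : (Q → ZMod 2) → ℂ

/-- The probability of a branch. -/
noncomputable def Branch.weight {Q B : Type} [Fintype Q] [DecidableEq Q] (s : Branch Q B) : ℝ :=
  ∑ z, ‖s.amp z‖ ^ 2

namespace Op

variable {Q B : Type} [DecidableEq Q] [DecidableEq B]

/-- Whether a gate with the given classical control is applied. -/
def fires (ctrl : Option B) (c : B → ZMod 2) : Bool :=
  match ctrl with
  | none => true
  | some b => decide (c b = 1)

/-- The single-qubit gate `U` on qubit `i`, tensored with the identity on the other qubits. -/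
noncomputable def applyGate (U : Matrix (ZMod 2) (ZMod 2) ℂ) (i : Q)
    (ψ : (Q → ZMod 2) → ℂ) : (Q → ZMod 2) → ℂ :=
  fun z => ∑ r : ZMod 2, U (z i) r * ψ (Function.update z i r)

/-- The CNOT gate with control `i` and target `j`. -/
def applyCnot (i j : Q) (ψ : (Q → ZMod 2) → ℂ) : (Q → ZMod 2) → ℂ :=
  fun z => ψ (Function.update z j (z j + z i))

/-- The projection onto the basis states in which qubit `i` has value `r`. -/
def project (i : Q) (r : ZMod 2) (ψ : (Q → ZMod 2) → ℂ) : (Q → ZMod 2) → ℂ :=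
  fun z => if z i = r then ψ z else 0

/-- The branches into which an operation turns a branch: one, except for a measurement, which gives
one for each outcome. -/
noncomputable def step : Op Q B → Branch Q B → List (Branch Q B)
  | gate U i ctrl, s =>
      [⟨s.bits, if fires ctrl s.bits then applyGate U.1 i s.amp else s.amp⟩]
  | cnot i j _ ctrl, s =>
      [⟨s.bits, if fires ctrl s.bits then applyCnot i j s.amp else s.amp⟩]
  | measure i a, s =>
      [⟨Function.update s.bits a 0, project i 0 s.amp⟩,
        ⟨Function.update s.bits a 1, project i 1 s.amp⟩]
  | parity S a, s =>
      [⟨Function.update s.bits a (∑ b ∈ S, s.bits b), s.amp⟩]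

/-- The probability that, when the operations are carried out in order from the branch `s`, the
final contents of the classical bits lie in `E`. -/
noncomputable def prob [Fintype Q] (E : Set (B → ZMod 2)) : List (Op Q B) → Branch Q B → ℝ
  | [], s => E.indicator (fun _ => s.weight) s.bits
  | o :: os, s => ((o.step s).map (prob E os)).sum

end Op

/-- A circuit with classical input bits indexed by `ι` and classical output bits indexed by `κ`,
built from single-qubit gates, CNOT gates, intermediate measurements and classical parity gates.
It has finitely many qubits, all starting in state `|0⟩`, and finitely many classical bits: the
input bits and further work bits, which start at `0`. Its operations are grouped in layers of
pairwise independent operations. -/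
structure ParityCircuit (ι κ : Type) : Type 1 where
  qubit : Type
  work : Type
  [fintypeQubit : Fintype qubit]
  [decidableEqQubit : DecidableEq qubit]
  [fintypeWork : Fintype work]
  [decidableEqWork : DecidableEq work]
  layers : List (List (Op qubit (ι ⊕ work)))
  independent : ∀ L ∈ layers, L.Pairwise Op.Independent
  output : κ → ι ⊕ work

namespace ParityCircuit

attribute [instance] fintypeQubit decidableEqQubit fintypeWork decidableEqWork

variable {ι κ : Type}

/-- The number of layers; layers of gates, of measurements and of parity gates all count. -/
def depth (C : ParityCircuit ι κ) : ℕ := C.layers.length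

/-- The number of operations, qubits and work bits. -/
def size (C : ParityCircuit ι κ) : ℕ :=
  C.layers.flatten.length + Fintype.card C.qubit + Fintype.card C.work

/-- The initial branch on input `y`: the classical bits hold `y` and zeros, the qubits are in the
basis state `|0⋯0⟩`. -/
def init (C : ParityCircuit ι κ) (y : ι → ZMod 2) : Branch C.qubit (ι ⊕ C.work) where
  bits := Sum.elim y 0
  amp := Pi.single 0 1

/-- The probability that the circuit outputs `x` on input `y`. -/
noncomputable def outputProb [DecidableEq ι] (C : ParityCircuit ι κ) (y : ι → ZMod 2)
    (x : κ → ZMod 2) : ℝ :=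
  Op.prob {c | ∀ j, c (C.output j) = x j} C.layers.flatten (C.init y)

end ParityCircuit

/-- A family of `QNC⁰[⊕]`-circuits: constant depth, and size polynomial in the number of input
bits. -/
def IsQNC0Parity {ι κ : ℕ → Type} [∀ k, Fintype (ι k)] (C : ∀ k, ParityCircuit (ι k) (κ k)) :
    Prop :=
  (∃ d : ℕ, ∀ k, (C k).depth ≤ d) ∧
    ∃ p : Polynomial ℕ, ∀ k, (C k).size ≤ p.eval (Fintype.card (ι k))

/-- The Hadamard code: the codeword of `x ∈ 𝔽₂ᵏ` lists the inner products `⟨x, z⟩` over all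
`z ∈ 𝔽₂ᵏ`, so its `n = 2ᵏ` coordinates are indexed by `𝔽₂ᵏ`. -/
def hadamardCode {k : ℕ} (x : Fin k → ZMod 2) : (Fin k → ZMod 2) → ZMod 2 :=
  fun z => ∑ i, x i * z i

open Finset

/-! The circuit is Fourier sampling in the style of Bernstein and Vazirani. On the uniform
superposition of all `z` with signs `(-1) ^ y z`, a Hadamard transform and a measurement give `x`
with probability the square of the normalized correlation of `y` with the codeword of `x`, which is
at least `(2ε)²`.

The difficulty is to produce the signs in constant depth. As `[z = w] = 2⁻ᵏ ∑_S (-1)^⟨S, z + w⟩`,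
the phase `π y z` is a sum over pairs `(S, w)` of terms that depend on `z` only through the bit `⟨S,
z⟩`. Each term is a rotation of a qubit holding that bit, controlled by `y w` (`prod_inputPhase`).
It therefore suffices to superpose linear encodings of `z` that contain a separate copy of `⟨S, z⟩`
for every pair.

With copies of the variables and partial sums included, this code is cut out by parity checks on at
most three qubits, every qubit lying in at most three checks. Measuring the checks on a uniform
superposition (`prob_prepare`) leaves a random coset of the code. The shift back to the code is
linear in the syndrome (`coord`), so parity gates compute it.

Hadamard gates on all data qubits then Fourier transform the whole register. Applying the transpose
of the encoding to the outcomes, again by parity gates, recovers the transform on the cube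
(`sum_mul_encode`, `rotatedState_apply`). `outputProb_ge` adds up the branches. -/

theorem sum_zmod_two {M : Type*} [AddCommMonoid M] (f : ZMod 2 → M) : ∑ r, f r = f 0 + f 1 :=
  Fin.sum_univ_two f

namespace Op

variable {Q B α : Type} [DecidableEq Q] [DecidableEq B]

/-! ### Layers of single-qubit gates -/

/-- The tensor product over all qubits of the single-qubit operators `U i`. -/
noncomputable def tensorApply [Fintype Q] (U : Q → Matrix (ZMod 2) (ZMod 2) ℂ)
    (ψ : (Q → ZMod 2) → ℂ) : (Q → ZMod 2) → ℂ :=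
  fun q => ∑ r : Q → ZMod 2, (∏ i, U i (q i) (r i)) * ψ r

theorem tensorApply_one [Fintype Q] (ψ : (Q → ZMod 2) → ℂ) :
    tensorApply (fun _ => 1) ψ = ψ := by
  funext q
  unfold tensorApply
  rw [Finset.sum_eq_single q]
  · simp
  · intro r _ hr
    obtain ⟨i, hi⟩ := Function.ne_iff.1 hr
    rw [Finset.prod_eq_zero (Finset.mem_univ i), zero_mul]
    exact Matrix.one_apply_ne' hi
  · simp

theorem tensorApply_single_zero [Fintype Q] (U : Q → Matrix (ZMod 2) (ZMod 2) ℂ)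
    (q : Q → ZMod 2) :
    tensorApply U (Pi.single 0 1) q = ∏ i, U i (q i) 0 := by
  unfold tensorApply
  rw [Finset.sum_eq_single 0]
  · simp
  · intro r _ hr
    simp [Pi.single_eq_of_ne hr]
  · simp

theorem applyGate_tensorApply [Fintype Q] (W : Matrix (ZMod 2) (ZMod 2) ℂ) (i : Q)
    (U : Q → Matrix (ZMod 2) (ZMod 2) ℂ) (ψ : (Q → ZMod 2) → ℂ) :
    applyGate W i (tensorApply U ψ) = tensorApply (Function.update U i (W * U i)) ψ := by
  funext q
  unfold applyGate tensorApply
  simp_rw [Finset.mul_sum]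
  rw [Finset.sum_comm]
  refine Finset.sum_congr rfl fun r _ => ?_
  simp_rw [← mul_assoc]
  rw [← Finset.sum_mul]
  congr 1
  rw [← Finset.mul_prod_erase univ _ (Finset.mem_univ i)]
  simp only [Function.update_self, Matrix.mul_apply, Finset.sum_mul]
  refine Finset.sum_congr rfl fun t _ => ?_
  rw [← Finset.mul_prod_erase univ _ (Finset.mem_univ i), ← mul_assoc]
  simp only [Function.update_self]
  congr 1
  refine Finset.prod_congr rfl fun j hj => ?_
  have hj' := Finset.ne_of_mem_erase hj
  rw [Function.update_of_ne hj', Function.update_of_ne hj']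

/-- A layer of classically controlled gates multiplies the tensor factors. -/
theorem prob_gates [Fintype Q] (E : Set (B → ZMod 2)) (os : List (Op Q B))
    (W : α → Matrix.unitaryGroup (ZMod 2) ℂ) (f : α → Q) (ctrl : α → Option B)
    (b : B → ZMod 2) (ψ : (Q → ZMod 2) → ℂ) (l : List α) (hl : (l.map f).Nodup)
    (U U' : Q → Matrix (ZMod 2) (ZMod 2) ℂ)
    (h₁ : ∀ a ∈ l, U' (f a) = (if fires (ctrl a) b then (W a).1 else 1) * U (f a))
    (h₂ : ∀ i, i ∉ l.map f → U' i = U i) :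
    prob E (l.map (fun a => gate (W a) (f a) (ctrl a)) ++ os) ⟨b, tensorApply U ψ⟩ =
      prob E os ⟨b, tensorApply U' ψ⟩ := by
  induction l generalizing U with
  | nil =>
    obtain rfl : U' = U := funext fun i => h₂ i (by simp)
    rfl
  | cons a l ih =>
    rw [List.map_cons, List.nodup_cons] at hl
    rw [List.map_cons, List.cons_append, prob]
    simp only [step, List.map_cons, List.map_nil, List.sum_cons, List.sum_nil, add_zero]
    have key : (if fires (ctrl a) b then applyGate (W a).1 (f a) (tensorApply U ψ)
        else tensorApply U ψ) =
        tensorApply (Function.update U (f a)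
          ((if fires (ctrl a) b then (W a).1 else 1) * U (f a))) ψ := by
      split_ifs
      · exact applyGate_tensorApply _ _ _ _
      · rw [one_mul, Function.update_eq_self]
    rw [key]
    refine ih hl.2 _ ?_ ?_
    · intro c hc
      rw [h₁ c (List.mem_cons_of_mem _ hc), Function.update_of_ne]
      intro h
      exact hl.1 (h ▸ List.mem_map_of_mem hc)
    · intro i hi
      by_cases h : i = f a
      · subst h
        rw [Function.update_self, h₁ a (by simp)]
      · rw [Function.update_of_ne h, h₂ i]
        simpa [h] using hi

/-- A layer of gates on all qubits `f a`, started from an arbitrary state. -/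
theorem prob_gates_univ [Fintype Q] [Fintype α] (E : Set (B → ZMod 2)) (os : List (Op Q B))
    (W : α → Matrix.unitaryGroup (ZMod 2) ℂ) (f : α → Q) (hf : f.Injective)
    (ctrl : α → Option B)
    (b : B → ZMod 2) (ψ : (Q → ZMod 2) → ℂ)
    (U U' : Q → Matrix (ZMod 2) (ZMod 2) ℂ)
    (h₁ : ∀ a, U' (f a) = (if fires (ctrl a) b then (W a).1 else 1) * U (f a))
    (h₂ : ∀ i, i ∉ Set.range f → U' i = U i) :
    prob E ((univ : Finset α).toList.map (fun a => gate (W a) (f a) (ctrl a)) ++ os)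
        ⟨b, tensorApply U ψ⟩ =
      prob E os ⟨b, tensorApply U' ψ⟩ := by
  refine prob_gates E os W f ctrl b ψ _ ((Finset.nodup_toList _).map hf) U U'
    (fun a _ => h₁ a) fun i hi => h₂ i ?_
  simpa using hi

/-! ### CNOT gates from one register to another -/

/-- CNOT gates with controls in one register and targets in another all commute; together they add
to every target the sum of its controls. -/
theorem prob_cnots {V K : Type} [Fintype V] [Fintype K] [DecidableEq V] [DecidableEq K]
    (E : Set (B → ZMod 2)) (os : List (Op (V ⊕ K) B))
    (b : B → ZMod 2) (l : List (V × K)) (ψ : (V ⊕ K → ZMod 2) → ℂ) :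
    prob E (l.map (fun p => cnot (Sum.inl p.1) (Sum.inr p.2) Sum.inl_ne_inr none) ++ os) ⟨b, ψ⟩ =
      prob E os ⟨b, fun q => ψ (Sum.elim (fun v => q (Sum.inl v)) fun u => q (Sum.inr u) +
        (l.map fun p => if p.2 = u then q (Sum.inl p.1) else 0).sum)⟩ := by
  induction l generalizing ψ with
  | nil =>
    have (q : V ⊕ K → ZMod 2) :
        Sum.elim (fun v => q (Sum.inl v)) (fun u => q (Sum.inr u)) = q := by
      funext i; cases i <;> rfl
    simp [this]
  | cons p l ih =>
    rw [List.map_cons, List.cons_append, prob]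
    simp only [step, fires, if_true, List.map_cons, List.map_nil, List.sum_cons, List.sum_nil,
      add_zero]
    rw [ih]
    congr 2
    funext q
    unfold applyCnot
    congr 1
    funext i
    rcases i with v | u
    · simp
    · by_cases h : u = p.2
      · subst h; simp; ring
      · simp [h, Ne.symm h]

/-! ### Layers of classical writes -/

/-- The bits after writing the values `m a` to the bits `g a` for `a` in the list. -/
def writeList (g : α → B) (m : α → ZMod 2) : List α → (B → ZMod 2) → (B → ZMod 2)
  | [], b => b
  | a :: l, b => writeList g m l (Function.update b (g a) (m a))

theorem writeList_congr (g : α → B) {m m' : α → ZMod 2} {l : List α}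
    (h : ∀ a ∈ l, m a = m' a) (b : B → ZMod 2) : writeList g m l b = writeList g m' l b := by
  induction l generalizing b with
  | nil => rfl
  | cons a l ih =>
    rw [writeList, writeList, h a (by simp), ih fun a ha => h a (by simp [ha])]

theorem writeList_of_notMem (g : α → B) (m : α → ZMod 2) {l : List α} (b : B → ZMod 2) {β : B}
    (h : β ∉ l.map g) : writeList g m l b β = b β := by
  induction l generalizing b with
  | nil => rfl
  | cons a l ih =>
    rw [List.map_cons, List.mem_cons, not_or] at h
    rw [writeList, ih _ h.2, Function.update_of_ne h.1]

theorem writeList_of_mem (g : α → B) (hg : g.Injective) (m : α → ZMod 2) {l : List α}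
    (b : B → ZMod 2) {a : α} (h : a ∈ l) : writeList g m l b (g a) = m a := by
  classical
  induction l generalizing b with
  | nil => simp at h
  | cons c l ih =>
    rw [writeList]
    by_cases ha : a ∈ l
    · exact ih _ ha
    · obtain rfl : a = c := by simpa [ha] using h
      rw [writeList_of_notMem, Function.update_self]
      simpa [hg.eq_iff] using ha

theorem writeList_univ [Fintype α] (g : α → B) (hg : g.Injective) (m : α → ZMod 2)
    (b : B → ZMod 2) :
    writeList g m (univ : Finset α).toList b = Function.extend g m b := by
  funext β
  by_cases h : ∃ a, g a = β
  · obtain ⟨a, rfl⟩ := h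
    rw [hg.extend_apply, writeList_of_mem g hg m b (by simp)]
  · rw [Function.extend_apply' _ _ _ h, writeList_of_notMem]
    simpa using h

/-- A layer of parity gates that do not read each other's outputs. -/
theorem prob_parities [Fintype Q] [Fintype α] (E : Set (B → ZMod 2)) (os : List (Op Q B))
    (S : α → Finset B) (g : α → B) (hg : g.Injective) (hS : ∀ a c, g c ∉ S a)
    (b : B → ZMod 2) (ψ : (Q → ZMod 2) → ℂ) :
    prob E ((univ : Finset α).toList.map (fun a => parity (S a) (g a)) ++ os) ⟨b, ψ⟩ =
      prob E os ⟨Function.extend g (fun a => ∑ β ∈ S a, b β) b, ψ⟩ := by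
  rw [← writeList_univ g hg]
  -- The current bits may differ from `b` only on outputs of the layer, which no gate of the layer
  -- reads. All parities can thus be evaluated on `b`.
  suffices H : ∀ (l : List α) (b' : B → ZMod 2), (∀ β, β ∉ Set.range g → b' β = b β) →
      prob E (l.map (fun a => parity (S a) (g a)) ++ os) ⟨b', ψ⟩ =
        prob E os ⟨writeList g (fun a => ∑ β ∈ S a, b β) l b', ψ⟩ from H _ b fun _ _ => rfl
  intro l
  induction l with
  | nil => intro b' _; rfl
  | cons a l ih =>
    intro b' hb
    rw [List.map_cons, List.cons_append, prob]
    simp only [step, List.map_cons, List.map_nil, List.sum_cons, List.sum_nil, add_zero]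
    have hs : ∑ β ∈ S a, b' β = ∑ β ∈ S a, b β := by
      refine Finset.sum_congr rfl fun β hβ => hb β ?_
      rintro ⟨c, rfl⟩
      exact hS a c hβ
    rw [hs, ih, writeList]
    intro β hβ
    rw [Function.update_of_ne, hb β hβ]
    rintro rfl
    exact hβ ⟨a, rfl⟩

/-! ### Layers of measurements -/

/-- Measuring distinct qubits gives one branch for every string of outcomes. -/
theorem prob_measures [Fintype Q] [Fintype α] [DecidableEq α] (E : Set (B → ZMod 2))
    (os : List (Op Q B)) (f : α → Q) (g : α → B) (hg : g.Injective) (b : B → ZMod 2)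
    (ψ : (Q → ZMod 2) → ℂ) :
    prob E ((univ : Finset α).toList.map (fun a => measure (f a) (g a)) ++ os) ⟨b, ψ⟩ =
      ∑ m : α → ZMod 2, prob E os ⟨Function.extend g m b,
        fun q => if ∀ a, q (f a) = m a then ψ q else 0⟩ := by
  -- Outcome strings are pinned to `0` off the list, so that a partial layer is still summed over
  -- functions on all of `α`, each string once.
  suffices H : ∀ (l : List α), l.Nodup → ∀ (b : B → ZMod 2) (ψ : (Q → ZMod 2) → ℂ),
      prob E (l.map (fun a => measure (f a) (g a)) ++ os) ⟨b, ψ⟩ =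
        ∑ m ∈ (univ : Finset (α → ZMod 2)).filter (fun m => ∀ a, a ∉ l → m a = 0),
          prob E os ⟨writeList g m l b, fun q => if ∀ a ∈ l, q (f a) = m a then ψ q else 0⟩ by
    rw [H _ (Finset.nodup_toList _)]
    simp [writeList_univ g hg]
  intro l
  induction l with
  | nil =>
    intro _ b ψ
    have : (univ : Finset (α → ZMod 2)).filter (fun m => ∀ a, a ∉ ([] : List α) → m a = 0) =
        {0} := by
      ext m; simp [funext_iff]
    rw [this]
    simp [writeList]
  | cons a l ih =>
    intro hl b ψ
    rw [List.nodup_cons] at hl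
    rw [List.map_cons, List.cons_append, prob]
    simp only [step, List.map_cons, List.map_nil, List.sum_cons, List.sum_nil, add_zero]
    rw [ih hl.2, ih hl.2]
    trans ∑ p ∈ (univ : Finset (ZMod 2)) ×ˢ
        (univ : Finset (α → ZMod 2)).filter (fun m => ∀ a, a ∉ l → m a = 0),
        prob E os ⟨writeList g p.2 l (Function.update b (g a) p.1),
          fun q => if ∀ a ∈ l, q (f a) = p.2 a then project (f a) p.1 ψ q else 0⟩
    · rw [Finset.sum_product, sum_zmod_two]
    refine Finset.sum_nbij' (fun p => Function.update p.2 a p.1)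
      (fun m => (m a, Function.update m a 0)) ?_ ?_ ?_ ?_ ?_
    · rintro ⟨r, m⟩ h
      simp only [mem_product, mem_univ, mem_filter, true_and, List.mem_cons, not_or] at h ⊢
      rintro c ⟨hc, hc'⟩
      rw [Function.update_of_ne hc, h c hc']
    · intro m h
      simp only [mem_product, mem_univ, mem_filter, true_and, List.mem_cons, not_or] at h ⊢
      intro c hc
      by_cases hca : c = a
      · subst hca; simp
      · rw [Function.update_of_ne hca, h c ⟨hca, hc⟩]
    · rintro ⟨r, m⟩ h
      simp only [mem_product, mem_univ, mem_filter, true_and] at h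
      have := h a hl.1
      simp only [Function.update_self, Function.update_idem, Prod.mk.injEq, true_and]
      rw [← this, Function.update_eq_self]
    · intro m _
      simp
    · rintro ⟨r, m⟩ h
      have hne : ∀ c ∈ l, Function.update m a r c = m c := fun c hc =>
        Function.update_of_ne (by rintro rfl; exact hl.1 hc) _ _
      rw [writeList, Function.update_self, writeList_congr g hne]
      congr 2
      funext q
      have : (∀ c ∈ a :: l, q (f c) = Function.update m a r c) ↔
          (∀ c ∈ l, q (f c) = m c) ∧ q (f a) = r := by
        rw [List.forall_mem_cons, Function.update_self, and_comm]
        exact and_congr_left fun _ => forall₂_congr fun c hc => by rw [hne c hc]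
      simp only [this, project]
      split_ifs <;> simp_all

end Op

namespace HadamardDecoder

/-! ### Signs -/

theorem zmod_two_cases (a : ZMod 2) : a = 0 ∨ a = 1 := by
  revert a
  decide

/-- The sign character `a ↦ (-1)ᵃ`. -/
def sgn : AddChar (ZMod 2) ℝ where
  toFun a := if a = 0 then 1 else -1
  map_zero_eq_one' := by simp
  map_add_eq_mul' a b := by
    rcases zmod_two_cases a with rfl | rfl <;> rcases zmod_two_cases b with rfl | rfl <;>
      simp [show (1 : ZMod 2) + 1 = 0 from rfl]

theorem sgn_one : sgn 1 = -1 := by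
  change (if (1 : ZMod 2) = 0 then (1 : ℝ) else -1) = -1
  simp

theorem sgn_sum {α : Type*} [Fintype α] (f : α → ZMod 2) : sgn (∑ i, f i) = ∏ i, sgn (f i) :=
  map_prod sgn.toMonoidHom (fun i => Multiplicative.ofAdd (f i)) univ

/-- Orthogonality of the characters of `𝔽₂ᵏ`. -/
theorem sum_sgn_dot {k : ℕ} (u : Fin k → ZMod 2) :
    ∑ S : Fin k → ZMod 2, sgn (∑ i, S i * u i) = if u = 0 then (2 : ℝ) ^ k else 0 := by
  have h1 : ∀ S : Fin k → ZMod 2, sgn (∑ i, S i * u i) = ∏ i, sgn (S i * u i) := fun S =>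
    sgn_sum _
  simp_rw [h1]
  -- The sum over the cube factors over coordinates; a coordinate with `u i = 1` gives the factor `1
  -- + (-1) = 0`.
  have h2 := Finset.prod_univ_sum (fun _ : Fin k => (univ : Finset (ZMod 2)))
    (fun i r => sgn (r * u i))
  rw [Fintype.piFinset_univ] at h2
  rw [← h2]
  simp_rw [sum_zmod_two]
  split_ifs with h
  · subst h; simp; norm_num
  · obtain ⟨i, hi⟩ := Function.ne_iff.1 h
    refine Finset.prod_eq_zero (Finset.mem_univ i) ?_
    rcases zmod_two_cases (u i) with h | h
    · exact absurd h hi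
    · simp [h, sgn_one]

/-! ### Gates -/

/-- The Hadamard gate. -/
noncomputable def hadamardGate : Matrix.unitaryGroup (ZMod 2) ℂ :=
  ⟨Matrix.of fun a b => (((√2)⁻¹ * sgn (a * b) : ℝ) : ℂ), by
    have h2 : (((√2 : ℝ) : ℂ))⁻¹ * (((√2 : ℝ) : ℂ))⁻¹ = 1 / 2 := by
      rw [← mul_inv, ← Complex.ofReal_mul, Real.mul_self_sqrt (by norm_num)]; norm_num
    rw [Matrix.mem_unitaryGroup_iff]
    ext i j
    rw [Matrix.mul_apply, sum_zmod_two]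
    rcases zmod_two_cases i with rfl | rfl <;> rcases zmod_two_cases j with rfl | rfl <;>
      simp [sgn_one, Matrix.star_apply, h2] <;> norm_num⟩

/-- The Pauli `X` gate. -/
noncomputable def notGate : Matrix.unitaryGroup (ZMod 2) ℂ :=
  ⟨Matrix.of fun a b => if a = b + 1 then 1 else 0, by
    rw [Matrix.mem_unitaryGroup_iff]
    ext i j
    rw [Matrix.mul_apply, sum_zmod_two]
    rcases zmod_two_cases i with rfl | rfl <;> rcases zmod_two_cases j with rfl | rfl <;>
      simp [Matrix.star_apply, show (1 : ZMod 2) + 1 = 0 from rfl]⟩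

/-- The phase `e^{± it}` acquired by the basis state `a`. -/
noncomputable def phase (t : ℝ) (a : ZMod 2) : ℂ := Complex.exp (((t * sgn a : ℝ) : ℂ) * Complex.I)

/-- The rotation `diag(e^{it}, e^{-it})`. -/
noncomputable def phaseGate (t : ℝ) : Matrix.unitaryGroup (ZMod 2) ℂ :=
  ⟨Matrix.diagonal (phase t), by
    rw [Matrix.mem_unitaryGroup_iff, Matrix.star_eq_conjTranspose, Matrix.diagonal_conjTranspose,
      Matrix.diagonal_mul_diagonal, ← Matrix.diagonal_one]
    congr 1
    funext a
    rw [Pi.star_apply, RCLike.star_def, Complex.mul_conj, Complex.normSq_eq_norm_sq, phase,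
      Complex.norm_exp_ofReal_mul_I]
    simp⟩

theorem notGate_controlled (r : ZMod 2) (a b : ZMod 2) :
    (if r = 1 then notGate.1 else 1) a b = if a = b + r then 1 else 0 := by
  rcases zmod_two_cases r with rfl | rfl
  · simp [Matrix.one_apply]
  · simp [notGate]

/-! ### Registers -/

abbrev Cube (k : ℕ) : Type := Fin k → ZMod 2

/-- Rows stand for pairs of a character and a point of the cube. -/
abbrev Row (k : ℕ) : Type := Fin (Fintype.card (Cube k × Cube k))

/-- The enumeration is arbitrary: it only orders the rows, so that the copies of a variable can be
chained from one row to the next. -/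
noncomputable def rowLabel (k : ℕ) : Row k ≃ Cube k × Cube k := (Fintype.equivFin _).symm

/-- The derived data qubits: in every row a copy of each of the `k` variables and the `k + 1`
partial sums of the inner product with the character of the row. -/
abbrev Derived (k : ℕ) : Type := Row k × (Fin k ⊕ Fin (k + 1))

/-- The data qubits: the `k` variables and the derived ones. -/
abbrev Data (k : ℕ) : Type := Fin k ⊕ Derived k

/-- The work bits: syndromes, corrections, outcomes of the final measurement, and outputs. -/
abbrev Work (k : ℕ) : Type := Derived k ⊕ Data k ⊕ Data k ⊕ Fin k

abbrev Bit (k : ℕ) : Type := Cube k ⊕ Work k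

variable {k : ℕ}

/-- The data qubit preceding a derived one: the previous copy of the same variable, or the previous
partial sum in the same row. -/
def prev : Derived k → Option (Data k)
  | (n, Sum.inl i) =>
      if n.val = 0 then some (Sum.inl i)
      else some (Sum.inr (⟨n.val - 1, lt_of_le_of_lt (Nat.sub_le _ _) n.isLt⟩, Sum.inl i))
  | (n, Sum.inr j) => Fin.cases none (fun i => some (Sum.inr (n, Sum.inr i.castSucc))) j

/-- The summand by which a partial sum differs from the previous one. -/
noncomputable def summand : Derived k → Option (Data k)
  | (_, Sum.inl _) => none
  | (n, Sum.inr j) =>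
      Fin.cases none (fun i => if (rowLabel k n).1 i = 1 then some (Sum.inr (n, Sum.inl i))
        else none) j

/-- Every data qubit controls at most one CNOT of the corresponding layer, which is why all of them
fit into a single layer. -/
theorem prev_injective {u u' : Derived k} {v : Data k} (h : prev u = some v)
    (h' : prev u' = some v) : u = u' := by
  obtain ⟨n, i | j⟩ := u <;> obtain ⟨n', i' | j'⟩ := u'
  · simp only [prev] at h h'
    split_ifs at h h' with h1 h2 h2 <;> rw [← h'] at h <;> simp at h
    · obtain rfl : n = n' := Fin.ext (by omega)
      rw [h]
    · obtain rfl : n = n' := Fin.ext (by omega)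
      rw [h.2]
  · exfalso
    simp only [prev] at h h'
    induction j' using Fin.cases <;> split_ifs at h <;> simp at h h' <;> simp [← h] at h'
  · exfalso
    simp only [prev] at h h'
    induction j using Fin.cases <;> split_ifs at h' <;> simp at h h' <;> simp [← h] at h'
  · simp only [prev] at h h'
    induction j using Fin.cases <;> induction j' using Fin.cases <;> simp at h h'
    rw [← h] at h'
    simp at h'
    rw [h'.1, h'.2]

theorem summand_injective {u u' : Derived k} {v : Data k} (h : summand u = some v)
    (h' : summand u' = some v) : u = u' := by
  obtain ⟨n, i | j⟩ := u <;> obtain ⟨n', i' | j'⟩ := u' <;> simp only [summand] at h h'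
  · simp at h
  · simp at h
  · simp at h'
  · induction j using Fin.cases <;> induction j' using Fin.cases <;> simp at h h'
    rw [← h.2] at h'
    simp at h'
    rw [h'.2.1, h'.2.2]

/-! ### Parity checks -/

/-- The parity checks of the data qubits, one for each derived qubit. -/
noncomputable def check : (Data k → ZMod 2) →ₗ[ZMod 2] (Derived k → ZMod 2) where
  toFun a u := a (Sum.inr u) + (prev u).elim 0 a + (summand u).elim 0 a
  map_add' a b := by
    funext u
    cases h : prev u <;> cases h' : summand u <;> simp [h, h'] <;> ring
  map_smul' c a := by
    funext u
    cases h : prev u <;> cases h' : summand u <;> simp [h, h'] <;> ring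

theorem check_apply (a : Data k → ZMod 2) (u : Derived k) :
    check a u = a (Sum.inr u) + (prev u).elim 0 a + (summand u).elim 0 a := rfl

/-- Zeros propagate: from the variables along the chains of copies, row by row, and then along the
partial sums within each row. -/
theorem eq_zero_of_check_eq_zero {a : Data k → ZMod 2} (h₀ : ∀ i, a (Sum.inl i) = 0)
    (h : check a = 0) : a = 0 := by
  have hc : ∀ (N : ℕ) (n : Row k) (i : Fin k), n.val = N → a (Sum.inr (n, Sum.inl i)) = 0 := by
    intro N
    induction N with
    | zero =>
      intro n i hn
      have := congrFun h (n, Sum.inl i)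
      simpa [check_apply, prev, summand, hn, h₀] using this
    | succ N ih =>
      intro n i hn
      have := congrFun h (n, Sum.inl i)
      rw [check_apply, prev, if_neg (by omega)] at this
      simpa [summand, ih ⟨n.val - 1, lt_of_le_of_lt (Nat.sub_le _ _) n.isLt⟩ i (by simp; omega)]
        using this
  funext v
  rcases v with i | ⟨n, i | j⟩
  · exact h₀ i
  · exact hc _ n i rfl
  · induction j using Fin.induction with
    | zero => simpa [check_apply, prev, summand] using congrFun h (n, Sum.inr 0)
    | succ j ih =>
      have := congrFun h (n, Sum.inr j.succ)
      rw [Pi.zero_apply] at ih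
      simp only [check_apply, prev, summand, Fin.cases_succ, Option.elim_some, ih] at this
      split_ifs at this
      · simpa [hc _ n j rfl] using this
      · simpa using this

/-- The variables together with the checks are linear coordinates on the data. -/
noncomputable def coordMap : (Data k → ZMod 2) →ₗ[ZMod 2] (Cube k × (Derived k → ZMod 2)) :=
  (LinearMap.funLeft (ZMod 2) (ZMod 2) Sum.inl).prod check

/-- Injectivity suffices because there is exactly one check per derived qubit, so the dimensions
agree. -/
noncomputable def coord : (Data k → ZMod 2) ≃ₗ[ZMod 2] (Cube k × (Derived k → ZMod 2)) :=
  coordMap.linearEquivOfInjective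
    (by
      rw [← LinearMap.ker_eq_bot, LinearMap.ker_eq_bot']
      intro a ha
      exact eq_zero_of_check_eq_zero (fun i => congrFun (congrArg Prod.fst ha) i)
        (congrArg Prod.snd ha))
    (by simp)

theorem coord_apply (a : Data k → ZMod 2) : coord a = (a ∘ Sum.inl, check a) := rfl

/-- The data with vanishing checks and given variables. -/
noncomputable def encode : Cube k →ₗ[ZMod 2] (Data k → ZMod 2) :=
  coord.symm.toLinearMap ∘ₗ LinearMap.inl _ _ _

/-- The data with given checks and vanishing variables. -/
noncomputable def correct : (Derived k → ZMod 2) →ₗ[ZMod 2] (Data k → ZMod 2) :=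
  coord.symm.toLinearMap ∘ₗ LinearMap.inr _ _ _

theorem encode_eq_iff (z : Cube k) (a : Data k → ZMod 2) :
    encode z = a ↔ (∀ i, a (Sum.inl i) = z i) ∧ check a = 0 := by
  change coord.symm (z, 0) = a ↔ _
  rw [LinearEquiv.symm_apply_eq, coord_apply, Prod.mk.injEq, eq_comm, funext_iff, @eq_comm _ 0]
  rfl

theorem encode_inl (z : Cube k) (i : Fin k) : encode z (Sum.inl i) = z i :=
  ((encode_eq_iff z _).1 rfl).1 i

theorem encode_add_correct (z : Cube k) (s : Derived k → ZMod 2) :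
    encode z + correct s = coord.symm (z, s) := by
  change coord.symm (z, 0) + coord.symm (0, s) = _
  rw [← map_add]
  simp

/-- The data with given checks are parametrized by the variables. -/
theorem sum_check_eq {M : Type*} [AddCommMonoid M] (s : Derived k → ZMod 2)
    (f : (Data k → ZMod 2) → M) :
    ∑ a, (if check a = s then f a else 0) = ∑ z, f (encode z + correct s) := by
  rw [← coord.symm.toEquiv.sum_comp, Fintype.sum_prod_type]
  refine Finset.sum_congr rfl fun z _ => ?_
  rw [Finset.sum_eq_single s]
  · rw [encode_add_correct, if_pos]
    · rfl
    · exact congrArg Prod.snd (coord.apply_symm_apply (z, s))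
  · intro t _ ht
    refine if_neg fun h => ht ?_
    rw [← h]
    exact (congrArg Prod.snd (coord.apply_symm_apply (z, t))).symm
  · simp

/-- The explicit form of the encoding. -/
noncomputable def partialSums (z : Cube k) : Data k → ZMod 2
  | Sum.inl i => z i
  | Sum.inr (_, Sum.inl i) => z i
  | Sum.inr (n, Sum.inr j) => ∑ i, if i.val < j.val then (rowLabel k n).1 i * z i else 0

theorem encode_eq_partialSums (z : Cube k) : encode z = partialSums z := by
  have two (x : ZMod 2) : x + x = 0 := CharTwo.add_self_eq_zero x
  refine (encode_eq_iff z _).2 ⟨fun i => rfl, ?_⟩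
  funext u
  obtain ⟨n, i | j⟩ := u
  · rw [check_apply, prev]
    split_ifs <;> simp [summand, partialSums, two]
  · induction j using Fin.cases with
    | zero => simp [check_apply, prev, summand, partialSums]
    | succ j =>
      -- The partial sum up to and including `j` is the previous one plus the term at `j`, which is
      -- what the check compares.
      have hs : ∑ i : Fin k, (if i.val < j.val + 1 then (rowLabel k n).1 i * z i else 0) =
          ∑ i : Fin k, (if i.val < j.val then (rowLabel k n).1 i * z i else 0) +
            (rowLabel k n).1 j * z j := by
        rw [← Fintype.sum_ite_eq j (fun i => (rowLabel k n).1 i * z i), ← Finset.sum_add_distrib]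
        refine Finset.sum_congr rfl fun i _ => ?_
        rcases lt_trichotomy i j with h | h | h
        · have : i.val < j.val := h
          rw [if_pos (by omega), if_pos this, if_neg h.ne', add_zero]
        · subst h; simp
        · have : j.val < i.val := h
          rw [if_neg (by omega), if_neg (by omega), if_neg h.ne, add_zero]
      simp only [check_apply, prev, summand, Fin.cases_succ, Option.elim_some, partialSums,
        Fin.val_succ, Fin.val_castSucc, hs]
      rcases zmod_two_cases ((rowLabel k n).1 j) with h | h
      · simp [h, two]
      · simp only [h, if_true, Option.elim_some, partialSums, one_mul, Pi.zero_apply]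
        linear_combination
          two (∑ i : Fin k, if i.val < j.val then (rowLabel k n).1 i * z i else 0) + two (z j)

theorem encode_last (z : Cube k) (n : Row k) :
    encode z (Sum.inr (n, Sum.inr (Fin.last k))) = ∑ i, (rowLabel k n).1 i * z i := by
  simp [encode_eq_partialSums, partialSums]

/-- Each coordinate of a linear map over `𝔽₂` is the parity of a fixed set of inputs, hence one
parity gate. This serves both the correction and the output. -/
theorem linearMap_apply_eq_sum {α β : Type} [Fintype α] [DecidableEq α]
    (L : (α → ZMod 2) →ₗ[ZMod 2] (β → ZMod 2)) (s : α → ZMod 2) (v : β) :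
    L s v = ∑ u, if L (Pi.single u 1) v = 1 then s u else 0 := by
  conv_lhs => rw [LinearMap.pi_apply_eq_sum_univ L s]
  rw [Finset.sum_apply]
  refine Finset.sum_congr rfl fun u _ => ?_
  have hu : (fun j => if u = j then (1 : ZMod 2) else 0) = Pi.single u 1 := by
    funext j; simp [Pi.single_apply, eq_comm]
  rw [hu]
  rcases zmod_two_cases (L (Pi.single u 1) v) with h | h
  · simp [h]
  · simp [h]

/-! ### The circuit -/

/-- The qubits: data, and one ancilla for each parity check. -/
abbrev Qubit (k : ℕ) : Type := Data k ⊕ Derived k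

def syndromeBit (u : Derived k) : Bit k := Sum.inr (Sum.inl u)

def correctionBit (v : Data k) : Bit k := Sum.inr (Sum.inr (Sum.inl v))

def outcomeBit (v : Data k) : Bit k := Sum.inr (Sum.inr (Sum.inr (Sum.inl v)))

def outputBit (i : Fin k) : Bit k := Sum.inr (Sum.inr (Sum.inr (Sum.inr i)))

theorem syndromeBit_injective : (syndromeBit (k := k)).Injective := fun _ _ h => by
  simpa [syndromeBit] using h

theorem correctionBit_injective : (correctionBit (k := k)).Injective := fun _ _ h => by
  simpa [correctionBit] using h

theorem outcomeBit_injective : (outcomeBit (k := k)).Injective := fun _ _ h => by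
  simpa [outcomeBit] using h

theorem outputBit_injective : (outputBit (k := k)).Injective := fun _ _ h => by
  simpa [outputBit] using h

noncomputable def hadamardLayer (k : ℕ) : List (Op (Qubit k) (Bit k)) :=
  (univ : Finset (Data k)).toList.map fun v => Op.gate hadamardGate (Sum.inl v) none

/-- The pairs `(f u, u)`, where `f u` is defined. -/
noncomputable def pairs (f : Derived k → Option (Data k)) : List (Data k × Derived k) :=
  (univ : Finset (Derived k)).toList.filterMap fun u => (f u).map fun v => (v, u)

/-- CNOT gates from data qubits to ancillas. -/
def cnotLayer (l : List (Data k × Derived k)) : List (Op (Qubit k) (Bit k)) :=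
  l.map fun p => Op.cnot (Sum.inl p.1) (Sum.inr p.2) Sum.inl_ne_inr none

noncomputable def syndromeLayer (k : ℕ) : List (Op (Qubit k) (Bit k)) :=
  (univ : Finset (Derived k)).toList.map fun u => Op.measure (Sum.inr u) (syndromeBit u)

/-- The bits whose sum is the correction of the data qubit `v`. -/
noncomputable def correctionSet (v : Data k) : Finset (Bit k) :=
  (univ.filter fun u => correct (Pi.single u 1) v = 1).map ⟨syndromeBit, syndromeBit_injective⟩

noncomputable def correctionLayer (k : ℕ) : List (Op (Qubit k) (Bit k)) :=
  (univ : Finset (Data k)).toList.map fun v => Op.parity (correctionSet v) (correctionBit v)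

noncomputable def notLayer (k : ℕ) : List (Op (Qubit k) (Bit k)) :=
  (univ : Finset (Data k)).toList.map fun v =>
    Op.gate notGate (Sum.inl v) (some (correctionBit v))

/-- The last partial sum of a row, which is the whole inner product. -/
def rowEnd (n : Row k) : Data k := Sum.inr (n, Sum.inr (Fin.last k))

/-- The rotation angle in a row. -/
noncomputable def angle (n : Row k) : ℝ :=
  Real.pi / 2 ^ k * sgn (∑ i, (rowLabel k n).1 i * (rowLabel k n).2 i)

noncomputable def phaseLayer (k : ℕ) : List (Op (Qubit k) (Bit k)) :=
  (univ : Finset (Row k)).toList.map fun n =>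
    Op.gate (phaseGate (angle n)) (Sum.inl (rowEnd n)) (some (Sum.inl (rowLabel k n).2))

noncomputable def outcomeLayer (k : ℕ) : List (Op (Qubit k) (Bit k)) :=
  (univ : Finset (Data k)).toList.map fun v => Op.measure (Sum.inl v) (outcomeBit v)

/-- The outcomes whose sum is the output bit `i`. -/
noncomputable def outputSet (i : Fin k) : Finset (Bit k) :=
  (univ.filter fun v => encode (Pi.single i 1) v = 1).map ⟨outcomeBit, outcomeBit_injective⟩

noncomputable def outputLayer (k : ℕ) : List (Op (Qubit k) (Bit k)) :=
  (univ : Finset (Fin k)).toList.map fun i => Op.parity (outputSet i) (outputBit i)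

noncomputable def layers (k : ℕ) : List (List (Op (Qubit k) (Bit k))) :=
  [hadamardLayer k, cnotLayer (pairs fun u => some (Sum.inr u)), cnotLayer (pairs prev),
    cnotLayer (pairs summand), syndromeLayer k, correctionLayer k, notLayer k, phaseLayer k,
    hadamardLayer k, outcomeLayer k, outputLayer k]

theorem pairwise_map_univ {α β : Type} [Fintype α] {R : β → β → Prop} (f : α → β)
    (h : ∀ a b, a ≠ b → R (f a) (f b)) :
    ((univ : Finset α).toList.map f).Pairwise R :=
  List.pairwise_map.2 ((Finset.nodup_toList _).imp fun hab => h _ _ hab)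

/-- Targets are distinct because each check has its own ancilla; controls are distinct by the
injectivity of `f`. -/
theorem cnotLayer_pairwise (f : Derived k → Option (Data k))
    (hf : ∀ u u' v, f u = some v → f u' = some v → u = u') :
    (cnotLayer (pairs f)).Pairwise Op.Independent := by
  refine List.pairwise_map.2 (List.Pairwise.filterMap _ (R := (· ≠ ·)) ?_ (Finset.nodup_toList _))
  intro u u' huu p hp p' hp'
  obtain ⟨v, hv, rfl⟩ := Option.map_eq_some_iff.1 hp
  obtain ⟨v', hv', rfl⟩ := Option.map_eq_some_iff.1 hp'
  have hvv : v ≠ v' := by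
    rintro rfl
    exact huu (hf _ _ _ hv hv')
  simp [Op.Independent, Op.qubits, Op.reads, Op.writes, huu.symm, hvv.symm]

theorem layers_independent : ∀ L ∈ layers k, L.Pairwise Op.Independent := by
  intro L hL
  simp only [layers, List.mem_cons, List.not_mem_nil, or_false] at hL
  rcases hL with rfl | rfl | rfl | rfl | rfl | rfl | rfl | rfl | rfl | rfl | rfl
  · exact pairwise_map_univ _ fun a b h => by
      simp [Op.Independent, Op.qubits, Op.reads, Op.writes, h]
  · exact cnotLayer_pairwise _ fun u u' v h h' => by simpa using h.trans h'.symm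
  · exact cnotLayer_pairwise _ fun u u' v => prev_injective
  · exact cnotLayer_pairwise _ fun u u' v => summand_injective
  · exact pairwise_map_univ _ fun a b h => by
      simp [Op.Independent, Op.qubits, Op.reads, Op.writes, h, syndromeBit_injective.eq_iff]
  · exact pairwise_map_univ _ fun a b h => by
      simp [Op.Independent, Op.qubits, Op.reads, Op.writes, h, correctionSet,
        syndromeBit, correctionBit]
  · exact pairwise_map_univ _ fun a b h => by
      simp [Op.Independent, Op.qubits, Op.reads, Op.writes, h]
  · exact pairwise_map_univ _ fun a b h => by
      simp [Op.Independent, Op.qubits, Op.reads, Op.writes, h, rowEnd]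
  · exact pairwise_map_univ _ fun a b h => by
      simp [Op.Independent, Op.qubits, Op.reads, Op.writes, h]
  · exact pairwise_map_univ _ fun a b h => by
      simp [Op.Independent, Op.qubits, Op.reads, Op.writes, h, outcomeBit_injective.eq_iff]
  · exact pairwise_map_univ _ fun a b h => by
      simp [Op.Independent, Op.qubits, Op.reads, Op.writes, h, outputSet, outcomeBit, outputBit]

/-- The decoder. The first six layers and the controlled `X` gates prepare the uniform
superposition of all encodings `encode z`; the rotations multiply the encoding of `z` by
`(-1) ^ y z`; and the last three layers carry out a Fourier transform. -/
noncomputable def decoder (k : ℕ) : ParityCircuit (Cube k) (Fin k) where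
  qubit := Qubit k
  work := Work k
  layers := layers k
  independent := layers_independent
  output := outputBit

theorem decoder_depth : (decoder k).depth = 11 := rfl

theorem length_pairs_le (f : Derived k → Option (Data k)) :
    (pairs f).length ≤ Fintype.card (Derived k) := by
  refine (List.length_filterMap_le _ _).trans ?_
  simp

theorem decoder_size_le :
    (decoder k).size ≤ 28 * (2 ^ k) ^ 3 + 15 * (2 ^ k) ^ 2 + 10 * 2 ^ k := by
  have hk : k ≤ 2 ^ k := Nat.lt_two_pow_self.le
  have h₁ := length_pairs_le (k := k) fun u => some (Sum.inr u)
  have h₂ := length_pairs_le (k := k) prev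
  have h₃ := length_pairs_le (k := k) summand
  have hR : Fintype.card (Row k) = (2 ^ k) ^ 2 := by simp [sq]
  have hK : Fintype.card (Derived k) = (2 ^ k) ^ 2 * (2 * k + 1) := by
    rw [Fintype.card_prod, hR, Fintype.card_sum, Fintype.card_fin, Fintype.card_fin]
    ring
  have hV : Fintype.card (Data k) = k + Fintype.card (Derived k) := by
    rw [Fintype.card_sum, Fintype.card_fin]
  have hQ : Fintype.card (decoder k).qubit = Fintype.card (Data k) + Fintype.card (Derived k) :=
    Fintype.card_sum
  have hW : Fintype.card (decoder k).work = Fintype.card (Derived k) +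
      (Fintype.card (Data k) + (Fintype.card (Data k) + k)) := by
    refine Fintype.card_sum.trans ?_
    rw [Fintype.card_sum (α := Data k), Fintype.card_sum (α := Data k), Fintype.card_fin]
  have hL : (layers k).flatten.length ≤ 5 * Fintype.card (Data k) + 4 * Fintype.card (Derived k) +
      Fintype.card (Row k) + k := by
    simp only [layers, hadamardLayer, cnotLayer, syndromeLayer, correctionLayer, notLayer,
      phaseLayer, outcomeLayer, outputLayer, List.flatten_cons, List.flatten_nil,
      List.length_append, List.length_map, Finset.length_toList, Finset.card_univ, List.length_nil]
    rw [Fintype.card_fin k]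
    omega
  have hL' : (decoder k).size = (layers k).flatten.length + Fintype.card (decoder k).qubit +
      Fintype.card (decoder k).work := rfl
  rw [hL', hQ, hW]
  -- With `V`, `D`, `R` the numbers of data qubits, derived qubits and rows, the total is at most
  -- `8V + 6D + R + 2k = 14D + R + 10k`. Bounding `k` by `2 ^ k` gives the coefficients 28, 15 and
  -- 10.
  have hm : (2 ^ k) ^ 2 * (2 * k + 1) ≤ (2 ^ k) ^ 2 * (2 * 2 ^ k + 1) :=
    Nat.mul_le_mul_left _ (by omega)
  have : (2 ^ k) ^ 2 * (2 * 2 ^ k + 1) = 2 * (2 ^ k) ^ 3 + (2 ^ k) ^ 2 := by ring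
  omega

/-! ### The state before the syndrome measurement -/

/-- Only the pair of `u` itself has target `u`, and it occurs at most once; this turns the effect of
the CNOT gates into the terms of `check`. -/
theorem sum_pairs (f : Derived k → Option (Data k)) (a : Data k → ZMod 2) (u : Derived k) :
    ((pairs f).map fun p => if p.2 = u then a p.1 else 0).sum = (f u).elim 0 a := by
  have h (l : List (Derived k)) :
      ((l.filterMap fun u => (f u).map fun v => (v, u)).map
        fun p => if p.2 = u then a p.1 else 0).sum =
      (l.map fun u' => if u' = u then (f u').elim 0 a else 0).sum := by
    induction l with
    | nil => rfl
    | cons u' l ih =>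
      rw [List.filterMap_cons]
      by_cases h : u' = u
      · subst h
        cases hu : f u' <;> simp [hu, ih]
      · cases hu : f u' <;> simp [h, ih]
  rw [pairs, h, Finset.sum_map_toList]
  simp

/-- The amplitude of each basis state in a uniform superposition of the data qubits. -/
noncomputable def uniformAmp (k : ℕ) : ℂ := (((√2)⁻¹ : ℝ) : ℂ) ^ Fintype.card (Data k)

/-- The uniform superposition of the data, with the values of the checks in the ancillas. -/
noncomputable def checkedState (q : Qubit k → ZMod 2) : ℂ :=
  if check (fun v => q (Sum.inl v)) = fun u => q (Sum.inr u) then uniformAmp k else 0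

/-- The ancillas start at `0`, so after the CNOT gates the amplitude is supported where ancilla plus
check vanishes, that is, where they agree. -/
theorem prob_prepare (E : Set (Bit k → ZMod 2)) (os : List (Op (Qubit k) (Bit k)))
    (b : Bit k → ZMod 2) :
    Op.prob E (hadamardLayer k ++ (cnotLayer (pairs fun u => some (Sum.inr u)) ++
      (cnotLayer (pairs prev) ++ (cnotLayer (pairs summand) ++ os)))) ⟨b, Pi.single 0 1⟩ =
    Op.prob E os ⟨b, checkedState⟩ := by
  have hU := Op.prob_gates_univ E (cnotLayer (pairs fun u => some (Sum.inr u)) ++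
      (cnotLayer (pairs prev) ++ (cnotLayer (pairs summand) ++ os)))
      (fun _ => hadamardGate) (Sum.inl : Data k → Qubit k) Sum.inl_injective (fun _ => none) b
      (Pi.single 0 1) (fun _ => 1) (Sum.elim (fun _ => hadamardGate.1) fun _ => 1)
      (by simp [Op.fires]) (by rintro (v | u) h <;> simp at h ⊢)
  rw [Op.tensorApply_one] at hU
  rw [hadamardLayer, hU]
  -- The three layers may be merged, since the formula for CNOT gates between two registers needs no
  -- disjointness.
  have happ : cnotLayer (pairs fun u => some (Sum.inr u)) ++
      (cnotLayer (pairs prev) ++ (cnotLayer (pairs summand) ++ os)) =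
      cnotLayer (k := k) ((pairs fun u => some (Sum.inr u)) ++ pairs prev ++ pairs summand) ++
        os := by
    simp [cnotLayer]
  rw [happ, cnotLayer, Op.prob_cnots]
  congr 2
  funext q
  rw [Op.tensorApply_single_zero, Fintype.prod_sum_type]
  simp only [Sum.elim_inl, Sum.elim_inr, List.map_append, List.sum_append,
    sum_pairs _ fun v => q (Sum.inl v)]
  have h1 : ∀ a, hadamardGate.1 a 0 = (((√2)⁻¹ : ℝ) : ℂ) := by simp [hadamardGate]
  simp only [h1, Finset.prod_const, Finset.card_univ]
  rw [checkedState]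
  have h2 : ∀ u, q (Sum.inr u) + ((some (Sum.inr u)).elim 0 (fun v => q (Sum.inl v)) +
      (prev u).elim 0 (fun v => q (Sum.inl v)) + (summand u).elim 0 (fun v => q (Sum.inl v))) =
      q (Sum.inr u) + check (fun v => q (Sum.inl v)) u := fun u => rfl
  rw [Finset.prod_congr rfl fun u _ => congrArg (fun t => (1 : Matrix (ZMod 2) (ZMod 2) ℂ) t 0)
    (h2 u)]
  split_ifs with h
  · rw [Finset.prod_eq_one, mul_one, uniformAmp]
    intro u _
    rw [h, CharTwo.add_self_eq_zero, Matrix.one_apply_eq]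
  · obtain ⟨u, hu⟩ := Function.ne_iff.1 h
    rw [Finset.prod_eq_zero (Finset.mem_univ u), mul_zero]
    refine Matrix.one_apply_ne fun h0 => hu ?_
    exact (CharTwo.add_eq_zero.1 h0).symm

/-! ### The state before the final measurement -/

/-- The phase that a data qubit acquires on input `y`. -/
noncomputable def inputPhase (y : Cube k → ZMod 2) : Data k → ZMod 2 → ℂ
  | Sum.inr (n, Sum.inr j) => fun a =>
      if j = Fin.last k ∧ y (rowLabel k n).2 = 1 then phase (angle n) a else 1
  | _ => fun _ => 1

/-- The operators applied to the qubits between the two rounds of measurements. -/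
noncomputable def gateProduct (y : Cube k → ZMod 2) (r : Data k → ZMod 2) :
    Qubit k → Matrix (ZMod 2) (ZMod 2) ℂ :=
  Sum.elim (fun v => hadamardGate.1 *
    (Matrix.diagonal (inputPhase y v) * if r v = 1 then notGate.1 else 1)) fun _ => 1

/-- All three layers consist of single-qubit gates whose controls are fixed in the branch, so they
compose to one tensor product. -/
theorem prob_rotate (E : Set (Bit k → ZMod 2)) (os : List (Op (Qubit k) (Bit k)))
    (b : Bit k → ZMod 2) (ψ : (Qubit k → ZMod 2) → ℂ) :
    Op.prob E (notLayer k ++ (phaseLayer k ++ (hadamardLayer k ++ os))) ⟨b, ψ⟩ =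
    Op.prob E os ⟨b, Op.tensorApply (gateProduct (fun w => b (Sum.inl w))
      fun v => b (correctionBit v)) ψ⟩ := by
  conv_lhs => rw [← Op.tensorApply_one ψ]
  rw [notLayer, Op.prob_gates_univ E _ (fun _ => notGate) (Sum.inl : Data k → Qubit k)
    Sum.inl_injective (fun v => some (correctionBit v)) b ψ (fun _ => 1)
    (Sum.elim (fun v => if b (correctionBit v) = 1 then notGate.1 else 1) fun _ => 1)
    (by simp [Op.fires]) (by rintro (v | u) h <;> simp at h ⊢)]
  rw [phaseLayer, Op.prob_gates_univ E _ (fun n => phaseGate (angle n))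
    (fun n : Row k => (Sum.inl (rowEnd n) : Qubit k)) (fun n n' h => by simpa [rowEnd] using h)
    (fun n => some (Sum.inl (rowLabel k n).2)) b ψ _
    (Sum.elim (fun v => Matrix.diagonal (inputPhase (fun w => b (Sum.inl w)) v) *
      if b (correctionBit v) = 1 then notGate.1 else 1) fun _ => 1) ?_ ?_]
  · rw [hadamardLayer, Op.prob_gates_univ E _ (fun _ => hadamardGate) (Sum.inl : Data k → Qubit k)
      Sum.inl_injective (fun _ => none) b ψ _ (gateProduct (fun w => b (Sum.inl w))
      fun v => b (correctionBit v)) (by simp [Op.fires, gateProduct])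
      (by rintro (v | u) h <;> simp [gateProduct] at h ⊢)]
  · intro n
    have : Matrix.diagonal (inputPhase (fun w => b (Sum.inl w)) (rowEnd n)) =
        if Op.fires (some (Sum.inl (rowLabel k n).2)) b then (phaseGate (angle n)).1 else 1 := by
      by_cases h : b (Sum.inl (rowLabel k n).2) = 1
      · simp [inputPhase, rowEnd, Op.fires, h, phaseGate]
      · simp only [inputPhase, rowEnd, Op.fires, h, and_false, if_false, decide_false]
        simp
    simp only [Sum.elim_inl]
    rw [this]
  · rintro (v | u) h
    · simp only [Sum.elim_inl]
      have : inputPhase (fun w => b (Sum.inl w)) v = fun _ => 1 := by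
        rcases v with i | ⟨n, i | j⟩
        · rfl
        · rfl
        · have hj : j ≠ Fin.last k := by
            rintro rfl
            exact h ⟨n, rfl⟩
          simp [inputPhase, hj]
      rw [this, Matrix.diagonal_one, one_mul]
    · rfl

/-! ### Output probabilities -/

/-- The branch state after the syndrome `s` has been measured and the gates have been applied. -/
noncomputable def rotatedState (y : Cube k → ZMod 2) (s : Derived k → ZMod 2) :
    (Qubit k → ZMod 2) → ℂ :=
  Op.tensorApply (gateProduct y (correct s)) fun q =>
    if ∀ u, q (Sum.inr u) = s u then checkedState q else 0

/-- The output computed from the outcomes of the final measurement. -/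
noncomputable def decode (m : Data k → ZMod 2) : Cube k :=
  fun i => ∑ v, if encode (Pi.single i 1) v = 1 then m v else 0

theorem outputProb_eq (y : Cube k → ZMod 2) (x : Cube k) :
    (decoder k).outputProb y x = ∑ s : Derived k → ZMod 2, ∑ m : Data k → ZMod 2,
      if decode m = x then
        ∑ q : Qubit k → ZMod 2, ‖if ∀ v, q (Sum.inl v) = m v then rotatedState y s q else 0‖ ^ 2
      else 0 := by
  change Op.prob (Q := Qubit k) (B := Bit k) {c | ∀ j, c (outputBit j) = x j}
    (layers k).flatten ⟨Sum.elim y 0, Pi.single 0 1⟩ = _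
  simp only [layers, List.flatten_cons, List.flatten_nil]
  rw [prob_prepare, syndromeLayer, Op.prob_measures _ _ _ _ syndromeBit_injective]
  refine Finset.sum_congr rfl fun s _ => ?_
  rw [correctionLayer, Op.prob_parities _ _ _ _ correctionBit_injective
    (by simp [correctionSet, syndromeBit, correctionBit]), prob_rotate]
  set b := Function.extend syndromeBit s (Sum.elim y 0 : Bit k → ZMod 2) with hb
  have hcor : (fun v => ∑ β ∈ correctionSet v, b β) = correct s := by
    funext v
    rw [correctionSet, Finset.sum_map, linearMap_apply_eq_sum, Finset.sum_filter]
    simp [hb, syndromeBit_injective.extend_apply]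
  -- Syndromes and corrections are written to work bits only, so the rotations are still controlled
  -- by the input.
  have hin (w : Cube k) : Function.extend correctionBit (correct s) b (Sum.inl w) = y w := by
    rw [Function.extend_apply' _ _ _ (by simp [correctionBit]), hb,
      Function.extend_apply' _ _ _ (by simp [syndromeBit])]
    rfl
  simp only [hcor, hin, correctionBit_injective.extend_apply]
  rw [outcomeLayer, Op.prob_measures _ _ _ _ outcomeBit_injective]
  refine Finset.sum_congr rfl fun m _ => ?_
  rw [outputLayer, Op.prob_parities _ _ _ _ outputBit_injective
    (by simp [outputSet, outcomeBit, outputBit]), Op.prob, Set.indicator_apply]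
  simp only [Set.mem_ofPred_eq, outputBit_injective.extend_apply]
  have hout (i : Fin k) (b : Bit k → ZMod 2) :
      ∑ β ∈ outputSet i, Function.extend outcomeBit m b β = decode m i := by
    rw [outputSet, Finset.sum_map, decode, Finset.sum_filter]
    simp [outcomeBit_injective.extend_apply]
  simp only [hout]
  by_cases h : decode m = x
  · rw [if_pos h, if_pos (congrFun h)]
    rfl
  · rw [if_neg h, if_neg fun h' => h (funext h')]

/-- The controlled `X` gate cancels the shift by `r v`; the phase and the Fourier sign then see the
uncorrupted value `a`. -/
theorem gateProduct_inl (y : Cube k → ZMod 2) (r : Data k → ZMod 2) (v : Data k)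
    (m a : ZMod 2) :
    gateProduct y r (Sum.inl v) m (a + r v) =
      (((√2)⁻¹ : ℝ) : ℂ) * ((sgn (m * a) : ℝ) : ℂ) * inputPhase y v a := by
  have h : a + r v + r v = a := by rw [add_assoc, CharTwo.add_self_eq_zero, add_zero]
  simp only [gateProduct, Sum.elim_inl]
  rw [Matrix.mul_apply, Finset.sum_eq_single a]
  · rw [Matrix.diagonal_mul, notGate_controlled, h, if_pos rfl, mul_one]
    simp [hadamardGate]
  · intro c _ hc
    rw [Matrix.diagonal_mul, notGate_controlled, h, if_neg hc, mul_zero, mul_zero]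
  · simp

/-- The phases of the data qubits multiply to the sign of the input bit. -/
theorem prod_inputPhase (y : Cube k → ZMod 2) (z : Cube k) :
    ∏ v, inputPhase y v (encode z v) = ((sgn (y z) : ℝ) : ℂ) := by
  have hrow (n : Row k) : ∏ j, inputPhase y (Sum.inr (n, Sum.inr j))
      (encode z (Sum.inr (n, Sum.inr j))) =
      Complex.exp (((if y (rowLabel k n).2 = 1 then
        angle n * sgn (∑ i, (rowLabel k n).1 i * z i) else 0 : ℝ) : ℂ) * Complex.I) := by
    rw [Finset.prod_eq_single (Fin.last k)]
    · rw [encode_last]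
      split_ifs with h <;> simp [inputPhase, h, phase]
    · intro j _ hj
      simp [inputPhase, hj]
    · simp
  rw [Fintype.prod_sum_type, Fintype.prod_prod_type]
  simp only [Fintype.prod_sum_type, hrow]
  simp only [inputPhase, Finset.prod_const_one, one_mul]
  rw [← Complex.exp_sum, ← Finset.sum_mul, ← Complex.ofReal_sum]
  -- Fourier inversion: for fixed `w`, summing over the characters `S` leaves `π` if `w = z` and `0`
  -- otherwise.
  have hsum : ∑ n : Row k, (if y (rowLabel k n).2 = 1 then
      angle n * sgn (∑ i, (rowLabel k n).1 i * z i) else 0) =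
      if y z = 1 then Real.pi else 0 := by
    rw [← (rowLabel k).symm.sum_comp]
    simp only [angle, Equiv.apply_symm_apply]
    rw [Fintype.sum_prod_type_right]
    have hw (w : Cube k) : ∑ S : Cube k, (if y w = 1 then
        Real.pi / 2 ^ k * sgn (∑ i, S i * w i) * sgn (∑ i, S i * z i) else 0) =
        if w = z then (if y z = 1 then Real.pi else 0) else 0 := by
      have hS (S : Cube k) : sgn (∑ i, S i * w i) * sgn (∑ i, S i * z i) =
          sgn (∑ i, S i * (w + z) i) := by
        rw [← AddChar.map_add_eq_mul, ← Finset.sum_add_distrib]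
        simp [mul_add]
      have hwz : w + z = 0 ↔ w = z := by
        simp [funext_iff, CharTwo.add_eq_zero]
      by_cases hy : y w = 1
      · simp only [hy, if_true, mul_assoc, hS]
        rw [← Finset.mul_sum, sum_sgn_dot]
        simp only [hwz]
        split_ifs with h1 h2
        · field_simp
        · exact absurd (h1 ▸ hy) h2
        · simp
      · simp only [hy, if_false, Finset.sum_const_zero]
        split_ifs with h1 h2
        · exact absurd (h1 ▸ h2) hy
        · rfl
        · rfl
    simp only [hw]
    simp
  rw [hsum]
  rcases zmod_two_cases (y z) with h | h
  · simp [h]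
  · simp [h, sgn_one]

/-- The correlation of `y` with the codeword of `x`. -/
noncomputable def correlation (y : Cube k → ZMod 2) (x : Cube k) : ℝ :=
  ∑ z, sgn (y z + ∑ i, x i * z i)

/-- `decode` is the transpose of `encode`, so a character of the data restricts on the code to the
character `decode m` of the cube. -/
theorem sum_mul_encode (m : Data k → ZMod 2) (z : Cube k) :
    ∑ v, m v * encode z v = ∑ i, decode m i * z i := by
  simp only [decode, Finset.sum_mul]
  rw [Finset.sum_comm]
  refine Finset.sum_congr rfl fun v _ => ?_
  rw [linearMap_apply_eq_sum, Finset.mul_sum]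
  refine Finset.sum_congr rfl fun i _ => ?_
  split_ifs <;> simp

/-- Once the correction is undone, the amplitude is a Fourier coefficient of the signs of `y`,
independent of the syndrome and dependent on the outcome only through its decoding. -/
theorem rotatedState_apply (y : Cube k → ZMod 2) (s : Derived k → ZMod 2)
    (m : Data k → ZMod 2) :
    rotatedState y s (Sum.elim m s) =
      ((((2 : ℝ)⁻¹ ^ Fintype.card (Data k) * correlation y (decode m)) : ℝ) : ℂ) := by
  have h2 : (((√2)⁻¹ : ℝ) : ℂ) * (((√2)⁻¹ : ℝ) : ℂ) = (((2 : ℝ)⁻¹ : ℝ) : ℂ) := by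
    rw [← Complex.ofReal_mul, ← mul_inv, Real.mul_self_sqrt (by norm_num)]
  rw [rotatedState, Op.tensorApply,
    ← (Equiv.sumArrowEquivProdArrow (Data k) (Derived k) (ZMod 2)).symm.sum_comp,
    Fintype.sum_prod_type]
  -- The ancillas have been measured and are acted on by the identity, so only the ancilla string
  -- `s` contributes.
  have hA (a : Data k → ZMod 2) : ∑ t : Derived k → ZMod 2,
      (∏ i, gateProduct y (correct s) i (Sum.elim m s i)
        ((Equiv.sumArrowEquivProdArrow (Data k) (Derived k) (ZMod 2)).symm (a, t) i)) *
      (if ∀ u, (Equiv.sumArrowEquivProdArrow (Data k) (Derived k) (ZMod 2)).symm (a, t)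
          (Sum.inr u) = s u then
        checkedState ((Equiv.sumArrowEquivProdArrow (Data k) (Derived k) (ZMod 2)).symm (a, t))
        else 0) =
      if check a = s then (∏ v, gateProduct y (correct s) (Sum.inl v) (m v) (a v)) * uniformAmp k
        else 0 := by
    rw [Finset.sum_eq_single s]
    · have hpos : ∀ u, (Equiv.sumArrowEquivProdArrow (Data k) (Derived k) (ZMod 2)).symm (a, s)
          (Sum.inr u) = s u := fun u => rfl
      rw [Fintype.prod_sum_type, if_pos hpos, checkedState]
      have h1 : ∏ u : Derived k, gateProduct y (correct s) (Sum.inr u)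
          (Sum.elim m s (Sum.inr u))
          ((Equiv.sumArrowEquivProdArrow (Data k) (Derived k) (ZMod 2)).symm (a, s)
            (Sum.inr u)) = 1 := by
        refine Finset.prod_eq_one fun u _ => ?_
        exact Matrix.one_apply_eq _
      rw [h1, mul_one]
      change _ * (if check a = s then _ else _) = _
      split_ifs
      · rfl
      · rw [mul_zero]
    · intro t _ ht
      rw [if_neg, mul_zero]
      exact fun h => ht (funext h)
    · simp
  simp only [hA]
  rw [sum_check_eq]
  -- Each data qubit contributes `1 / √2` twice, from its preparation and from its final Hadamard
  -- gate.
  have hz (z : Cube k) : (∏ v, gateProduct y (correct s) (Sum.inl v) (m v)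
      ((encode z + correct s) v)) * uniformAmp k =
      ((((2 : ℝ)⁻¹ ^ Fintype.card (Data k) * sgn (y z + ∑ i, decode m i * z i)) : ℝ) : ℂ) := by
    simp only [Pi.add_apply, gateProduct_inl]
    rw [Finset.prod_mul_distrib, Finset.prod_mul_distrib, prod_inputPhase, Finset.prod_const,
      Finset.card_univ, ← Complex.ofReal_prod, ← sgn_sum, sum_mul_encode, uniformAmp,
      AddChar.map_add_eq_mul, Complex.ofReal_mul, Complex.ofReal_mul, Complex.ofReal_pow, ← h2,
      mul_pow]
    ring
  simp only [hz]
  rw [← Complex.ofReal_sum, ← Finset.mul_sum, correlation]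

/-- The encoding is systematic: the outcome on variable `i` enters output `i` and no other.
Arbitrary outcomes on the derived qubits can therefore be completed to any prescribed decoding. -/
theorem decode_eq (m : Data k → ZMod 2) (i : Fin k) :
    decode m i = m (Sum.inl i) + decode (Sum.elim 0 fun u => m (Sum.inr u)) i := by
  simp only [decode, Fintype.sum_sum_type, Sum.elim_inl, Sum.elim_inr, encode_inl,
    Pi.zero_apply, ite_self, Finset.sum_const_zero, zero_add]
  congr 1
  rw [Finset.sum_eq_single i]
  · simp
  · intro j _ hj
    simp [hj]
  · simp

/-- Outcomes with a given decoding and given values on the derived qubits. -/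
noncomputable def outcomeWith (x : Cube k) (t : Derived k → ZMod 2) : Data k → ZMod 2 :=
  Sum.elim (fun i => x i + decode (Sum.elim 0 t) i) t

theorem decode_outcomeWith (x : Cube k) (t : Derived k → ZMod 2) :
    decode (outcomeWith x t) = x := by
  funext i
  rw [decode_eq]
  simp only [outcomeWith, Sum.elim_inl, Sum.elim_inr]
  rw [add_assoc, CharTwo.add_self_eq_zero, add_zero]

/-- With `D` derived qubits there are `2 ^ D` syndromes and, for each, at least `2 ^ D` outcomes
decoding to `x`, all with amplitude `2⁻⁽ᵏ⁺ᴰ⁾` times the correlation. The powers of `2 ^ D` cancel.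
-/
theorem outputProb_ge (y : Cube k → ZMod 2) (x : Cube k) :
    ((2 : ℝ)⁻¹ ^ k * correlation y x) ^ 2 ≤ (decoder k).outputProb y x := by
  rw [outputProb_eq]
  set D := (2 : ℝ)⁻¹ ^ Fintype.card (Data k) * correlation y x with hD
  have hs (s : Derived k → ZMod 2) : (2 : ℝ) ^ Fintype.card (Derived k) * D ^ 2 ≤
      ∑ m : Data k → ZMod 2, if decode m = x then
        ∑ q : Qubit k → ZMod 2, ‖if ∀ v, q (Sum.inl v) = m v then rotatedState y s q else 0‖ ^ 2
      else 0 := by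
    have hinj : (outcomeWith (k := k) x).Injective := fun t t' h =>
      funext fun u => congrFun h (Sum.inr u)
    calc (2 : ℝ) ^ Fintype.card (Derived k) * D ^ 2
        = ∑ _t : Derived k → ZMod 2, D ^ 2 := by simp
      _ ≤ ∑ t : Derived k → ZMod 2, if decode (outcomeWith x t) = x then
            ∑ q : Qubit k → ZMod 2, ‖if ∀ v, q (Sum.inl v) = outcomeWith x t v
              then rotatedState y s q else 0‖ ^ 2 else 0 := by
          refine Finset.sum_le_sum fun t _ => ?_
          rw [if_pos (decode_outcomeWith x t)]
          -- Of the basis states compatible with the outcome, only the one whose ancillas equal `s`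
          -- is kept; the other terms are nonnegative.
          refine le_trans ?_ (Finset.single_le_sum (fun q _ => by positivity)
            (Finset.mem_univ (Sum.elim (outcomeWith x t) s)))
          have hpos : ∀ v, Sum.elim (outcomeWith x t) s (Sum.inl v) = outcomeWith x t v :=
            fun v => rfl
          rw [if_pos hpos, rotatedState_apply, decode_outcomeWith, ← hD,
            Complex.norm_real, Real.norm_eq_abs, sq_abs]
      _ ≤ _ := by
          rw [← Finset.sum_image (s := univ) (g := outcomeWith x)
            (f := fun m => if decode m = x then ∑ q : Qubit k → ZMod 2,
              ‖if ∀ v, q (Sum.inl v) = m v then rotatedState y s q else 0‖ ^ 2 else 0)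
            (fun t _ t' _ h => hinj h)]
          refine Finset.sum_le_sum_of_subset_of_nonneg (Finset.subset_univ _) fun m _ _ => ?_
          positivity
  refine le_trans (le_of_eq ?_) (Finset.sum_le_sum fun s _ => hs s)
  have hV : Fintype.card (Data k) = k + Fintype.card (Derived k) := by
    rw [Fintype.card_sum, Fintype.card_fin]
  rw [Finset.sum_const, Finset.card_univ, hD, hV, nsmul_eq_mul, Fintype.card_fun, ZMod.card,
    pow_add]
  push_cast
  have h1 : (2 : ℝ) ^ Fintype.card (Derived k) * (2 : ℝ)⁻¹ ^ Fintype.card (Derived k) = 1 := by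
    rw [← mul_pow]; norm_num
  linear_combination (-((2 : ℝ)⁻¹ ^ k * correlation y x) ^ 2) *
    ((2 : ℝ) ^ Fintype.card (Derived k) * (2 : ℝ)⁻¹ ^ Fintype.card (Derived k) + 1) * h1

/-- Each agreement contributes `1` and each disagreement `-1`. -/
theorem correlation_eq (y : Cube k → ZMod 2) (x : Cube k) :
    correlation y x = 2 ^ k - 2 * hammingDist y (hadamardCode x) := by
  have h (z : Cube k) : sgn (y z + ∑ i, x i * z i) =
      1 - 2 * (if y z ≠ hadamardCode x z then 1 else 0) := by
    by_cases hz : y z = hadamardCode x z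
    · rw [if_neg (not_not.2 hz), hz]
      have : hadamardCode x z + ∑ i, x i * z i = 0 := CharTwo.add_self_eq_zero _
      rw [this]
      simp
    · rw [if_pos hz]
      have : y z + ∑ i, x i * z i = 1 := by
        rcases zmod_two_cases (y z + ∑ i, x i * z i) with h | h
        · exact absurd (CharTwo.add_eq_zero.1 h) hz
        · exact h
      rw [this, sgn_one]
      norm_num
  rw [correlation, Finset.sum_congr rfl fun z _ => h z, Finset.sum_sub_distrib, ← Finset.mul_sum,
    Finset.sum_boole, hammingDist]
  simp

end HadamardDecoder

theorem theorem4p1p1 :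
    ∃ C : (k : ℕ) → ParityCircuit (Fin k → ZMod 2) (Fin k),
      IsQNC0Parity C ∧ (∀ k, (C k).depth ≤ 65) ∧
      ∃ c : ℝ, 0 < c ∧
        ∀ (k : ℕ) (ε : ℝ), 0 < ε → ε ≤ 1 / 2 →
          ∀ (y : (Fin k → ZMod 2) → ZMod 2) (x : Fin k → ZMod 2),
            (hammingDist y (hadamardCode x) : ℝ) ≤ (1 / 2 - ε) * (2 : ℝ) ^ k →
            c * ε ^ 2 ≤ (C k).outputProb y x := by
  refine ⟨HadamardDecoder.decoder, ⟨⟨11, fun k => HadamardDecoder.decoder_depth.le⟩, ?_⟩,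
    fun k => ?_, 4, by norm_num, ?_⟩
  · refine ⟨28 * Polynomial.X ^ 3 + 15 * Polynomial.X ^ 2 + 10 * Polynomial.X, fun k => ?_⟩
    refine HadamardDecoder.decoder_size_le.trans (le_of_eq ?_)
    simp
  · rw [HadamardDecoder.decoder_depth]; norm_num
  · intro k ε hε _ y x hd
    refine le_trans ?_ (HadamardDecoder.outputProb_ge y x)
    have hp : (0 : ℝ) < 2 ^ k := by positivity
    -- The distance bound makes the normalized correlation at least `2ε`; squaring it gives the
    -- constant `4`.
    have h1 : 2 * ε ≤ (2 : ℝ)⁻¹ ^ k * HadamardDecoder.correlation y x := by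
      rw [HadamardDecoder.correlation_eq, inv_pow, inv_mul_eq_div, le_div_iff₀ hp]
      linarith
    calc 4 * ε ^ 2 = (2 * ε) ^ 2 := by ring
      _ ≤ _ := pow_le_pow_left₀ (by positivity) h1 2
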